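/- Let $k$ be a field of prime characteristic $p$, let $r_0,r_1,r_2\in k[t]$ be polynomials with $r_0r_2\neq 0$ and $2\deg r_1>\deg r_0+\deg r_2$, and let $$R=\frac{k[t,u,v,x,y]}{(r_0u^2x^2+r_1uxvy+r_2v^2y^2)},\qquad I=(u,v,x,y)\subseteq R.$$ For an ideal $J$ of $R$ and $q=p^e$ with $e\ge 0$, let $J^{[q]}$ denote the ideal generated by all $q$-th powers of elements of $J$ (equivalently, by the $q$-th powers of any set of generators of $J$), and write $J^{c[q]}=(J^c)^{[q]}$. Then the Frobenius powers of $I$ have linear growth of primary decompositions: there is a constant $c\in\mathbb N$ such that for every $q=p^e$, $e\ge 0$, there are finitely many primary ideals $Q_1,\dots,Q_s$ of $R$ (with $s$ depending on $q$) such that $$I^{[q]}=Q_1\cap Q_2\cap\cdots\cap Q_s\qquad\text{and}\qquad (\sqrt{Q_i})^{c[q]}\subseteq Q_i\quad\text{for all } i=1,\dots,s.$$ In particular, this holds for $r_0=r_2=1$, $r_1=t$, that is, for the ideal $(u,v,x,y)$ of $k[t,u,v,x,y]/(u^2x^2+tuxvy+v^2y^2)$. -/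

import Mathlib

open Polynomial

noncomputable section

/-- The `q`-th Frobenius power `I^[q]` of an ideal `I`, for `q` a power of the characteristic:
the ideal generated by the `q`-th powers of the elements of `I`. -/
def Ideal.frobeniusPower {R : Type*} [CommRing R] (q : ℕ) (I : Ideal R) : Ideal R :=
  Ideal.span ((fun a : R => a ^ q) '' (I : Set R))

/-- In characteristic `p`, the Frobenius power `I^[q]` is generated by the `q`-th powers of any
set of generators of `I`. -/
theorem Ideal.frobeniusPower_span {R : Type*} [CommRing R] (p : ℕ) [Fact p.Prime] [CharP R p]
    (e : ℕ) (S : Set R) :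
    (Ideal.span S).frobeniusPower (p ^ e) = Ideal.span ((fun a : R => a ^ p ^ e) '' S) := by
  have h : (fun a : R => a ^ p ^ e) = iterateFrobenius R p e := by
    ext a; rw [iterateFrobenius_def]
  rw [Ideal.frobeniusPower, h, ← Ideal.map_span, ← Ideal.map_span, Ideal.span_eq]

/-- The Frobenius powers of `I`, in a ring of prime characteristic `p`, have linear growth of
primary decompositions: there is a constant `c` such that for every `q = p ^ e` the ideal `I^[q]`
is a finite intersection of primary ideals `Q` with `(√Q)^{c[q]} = ((√Q)^c)^[q] ⊆ Q`. -/
def HasLinearGrowthOfPrimaryDecompositions {R : Type*} [CommRing R] (p : ℕ) (I : Ideal R) :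
    Prop :=
  ∃ c : ℕ, ∀ e : ℕ, ∃ D : Finset (Ideal R),
    (∀ Q ∈ D, Q.IsPrimary) ∧
    D.inf id = I.frobeniusPower (p ^ e) ∧
    ∀ Q ∈ D, (Q.radical ^ c).frobeniusPower (p ^ e) ≤ Q

namespace SSHypersurface

/-- The polynomial ring `k[t,u,v,x,y]`, presented as `k[t][u,v,x,y]`; the variables `u, v, x, y`
are numbered `0, 1, 2, 3`. -/
abbrev PolyRing (k : Type*) [Field k] : Type _ := MvPolynomial (Fin 4) k[X]

/-- The polynomial `r₀u²x² + r₁uxvy + r₂v²y²`, where `r₀, r₁, r₂ ∈ k[t]`. -/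
def equation {k : Type*} [Field k] (r₀ r₁ r₂ : k[X]) : PolyRing k :=
  let u : PolyRing k := MvPolynomial.X 0
  let v : PolyRing k := MvPolynomial.X 1
  let x : PolyRing k := MvPolynomial.X 2
  let y : PolyRing k := MvPolynomial.X 3
  MvPolynomial.C r₀ * u ^ 2 * x ^ 2 + MvPolynomial.C r₁ * u * x * v * y +
    MvPolynomial.C r₂ * v ^ 2 * y ^ 2

/-- The coordinate ring `k[t,u,v,x,y]/(r₀u²x² + r₁uxvy + r₂v²y²)` of the hypersurface. -/
abbrev CoordRing {k : Type*} [Field k] (r₀ r₁ r₂ : k[X]) : Type _ :=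
  PolyRing k ⧸ Ideal.span {equation r₀ r₁ r₂}

/-- The ideal `(u, v, x, y)` of the coordinate ring. -/
def idealUVXY {k : Type*} [Field k] (r₀ r₁ r₂ : k[X]) : Ideal (CoordRing r₀ r₁ r₂) :=
  Ideal.span (Set.range fun i : Fin 4 =>
    (Ideal.Quotient.mk (Ideal.span {equation r₀ r₁ r₂}) (MvPolynomial.X i) :
      CoordRing r₀ r₁ r₂))

end SSHypersurface

end

/-! The ideal `I` is the kernel of a retraction `ε : R → k[t]`, so `z^q ≡ ε(z)^q` modulo `I^[q]`:
every `q`-th power acts as a scalar of `k[t]`. Hence the elements that are `k[t]`-torsion modulo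
`I^[q]` form an `I`-primary ideal, and for `τ` irreducible `I^[q] + (τ^(cq))` is primary to the
maximal ideal `ε⁻¹(τ)`. Finitely many of these intersect in `I^[q]` as soon as the product `s` of
the relevant `τ` satisfies: `s^(cq)` kills the torsion
(`hasLinearGrowthOfPrimaryDecompositions_ker`).

The linear exponent comes from a multigrading in which the equation is homogeneous and each
multidegree contains at most `q` monomials with all exponents below `q` (`SmallExponent.card_le`).
Each graded piece of `R/I^[q]` is thus the cokernel over `k[t]` of a matrix with at most `q` rows
and entries of degree at most `D`, a bound for the `t`-degrees of the coefficients of the equation.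
By Cramer's rule its torsion elements have nonzero annihilators of degree at most `Dq`
(`exists_natDegree_le_smul_mem_span`), hence with at most `Dq` irreducible factors. -/

noncomputable section

/-! ### Degree bounds for annihilators of torsion over `k[X]` -/

/-- Over a field, a set of vectors can be completed by standard basis vectors. -/
theorem exists_basis_of_set_and_single {K ι : Type*} [Field K] [Fintype ι] [DecidableEq ι]
    (C : Set (ι → K)) :
    ∃ B : ι → (ι → K), LinearIndependent K B ∧
      (∀ j, B j ∈ C ∨ ∃ i, B j = Pi.single i 1) ∧
      Submodule.span K C ≤ Submodule.span K (B '' {j | B j ∈ C}) := by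
  obtain ⟨b₀, hb₀C, hb₀s, hb₀i⟩ := exists_linearIndependent K C
  obtain ⟨b, hbt, hb₀b, htb, hbi⟩ := exists_linearIndepOn_id_extension (K := K) hb₀i
    (Set.subset_union_left (s := b₀) (t := Set.range fun i : ι => (Pi.single i 1 : ι → K)))
  have hspan : ⊤ ≤ Submodule.span K (Set.range ((↑) : b → ι → K)) := by
    rw [Subtype.range_coe, ← (Pi.basisFun K ι).span_eq, Submodule.span_le]
    rintro _ ⟨i, rfl⟩
    exact htb (Or.inr ⟨i, by simp⟩)
  let bas : Module.Basis b K (ι → K) := Module.Basis.mk hbi hspan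
  let φ : b ≃ ι := bas.indexEquiv (Pi.basisFun K ι)
  refine ⟨fun j => (φ.symm j : ι → K), hbi.comp _ φ.symm.injective, fun j => ?_, ?_⟩
  · rcases hbt (φ.symm j).2 with h | ⟨i, h⟩
    · exact Or.inl (hb₀C h)
    · exact Or.inr ⟨i, h.symm⟩
  · rw [← hb₀s]
    refine Submodule.span_mono fun x hx => ⟨φ ⟨x, hb₀b hx⟩, ?_, ?_⟩
    · simpa using hb₀C hx
    · simp

theorem Matrix.natDegree_det_le_card_mul {k ι : Type*} [CommRing k] [Fintype ι] [DecidableEq ι]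
    (M : Matrix ι ι k[X]) (D : ℕ) (hM : ∀ i j, (M i j).natDegree ≤ D) :
    M.det.natDegree ≤ Fintype.card ι * D := by
  rw [Matrix.det_apply]
  refine natDegree_sum_le_of_forall_le _ _ fun σ _ => ?_
  refine (natDegree_smul_le _ _).trans ((natDegree_prod_le _ _).trans ?_)
  exact (Finset.sum_le_card_nsmul _ _ D fun i _ => hM _ _).trans (by simp)

/-- A vector of `k[X]^ι` which is torsion modulo the span of vectors of degree at most `D` is
annihilated, modulo this span, by a nonzero polynomial of degree at most `D` times the rank. -/
theorem exists_natDegree_le_smul_mem_span {k ι : Type*} [Field k] [Fintype ι] (K : Type*)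
    [Field K] [Algebra k[X] K] [IsFractionRing k[X] K]
    (C : Set (ι → k[X])) (D : ℕ) (hC : ∀ c ∈ C, ∀ i, (c i).natDegree ≤ D) (v : ι → k[X])
    (g : k[X]) (hg : g ≠ 0) (hv : g • v ∈ Submodule.span k[X] C) :
    ∃ δ : k[X], δ ≠ 0 ∧ δ.natDegree ≤ Fintype.card ι * D ∧
      δ • v ∈ Submodule.span k[X] C := by
  classical
  let φ : (ι → k[X]) →ₗ[k[X]] (ι → K) := (Algebra.linearMap k[X] K).compLeft ι
  have hφ (w : ι → k[X]) (i : ι) : φ w i = algebraMap k[X] K (w i) := rfl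
  obtain ⟨B, hBi, hBC, hBs⟩ := exists_basis_of_set_and_single (φ '' C)
  -- The vectors completing the basis are standard ones, with entries of degree 0, so every column
  -- of `M` still has degree at most `D`.
  have hlift : ∀ j, ∃ w : ι → k[X], φ w = B j ∧ (∀ i, (w i).natDegree ≤ D) ∧
      (B j ∈ φ '' C → w ∈ C) := by
    intro j
    by_cases hj : B j ∈ φ '' C
    · obtain ⟨w, hw, hwj⟩ := hj
      exact ⟨w, hwj, hC w hw, fun _ => hw⟩
    · obtain ⟨i, hi⟩ := (hBC j).resolve_left hj
      refine ⟨Pi.single i 1, ?_, fun l => ?_, fun h => absurd h hj⟩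
      · rw [hi]
        ext l
        rw [hφ]
        by_cases h : l = i
        · subst h; simp
        · simp [h]
      · by_cases h : l = i
        · subst h; simp
        · simp [h]
  choose W hWB hWD hWC using hlift
  let M : Matrix ι ι k[X] := Matrix.of fun i j => W j i
  have hMdet : M.det ≠ 0 := by
    intro h0
    have h1 : (M.map (algebraMap k[X] K)).det = 0 := by
      have := RingHom.map_det (algebraMap k[X] K) M
      rw [h0, map_zero] at this
      exact this.symm
    have h2 : LinearIndependent K (M.map (algebraMap k[X] K)).col := by
      convert hBi using 1
      ext j i
      rw [← hWB j, hφ]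
      rfl
    rw [Matrix.linearIndependent_cols_iff_isUnit, Matrix.isUnit_iff_isUnit_det, h1] at h2
    exact not_isUnit_zero h2
  -- Cramer's rule gives integral coordinates of `det M • v` in the columns of `M`.
  let x := M.adjugate.mulVec v
  have hx : M.det • v = ∑ j, x j • W j := by
    have : M.mulVec x = M.det • v := by
      simp only [x]
      rw [Matrix.mulVec_mulVec, Matrix.mul_adjugate, Matrix.smul_mulVec, Matrix.one_mulVec]
    rw [← this]
    ext i
    simp [Matrix.mulVec, dotProduct, M, mul_comm]
  refine ⟨M.det, hMdet, Matrix.natDegree_det_le_card_mul M D fun i j => hWD j i, ?_⟩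
  have hgK : algebraMap k[X] K g ≠ 0 := by
    simpa using hg
  have hvK : φ v ∈ Submodule.span K (φ '' C) := by
    have h1 : φ (g • v) ∈ Submodule.span K (φ '' C) := by
      have : φ (g • v) ∈ (Submodule.span k[X] C).map φ := Submodule.mem_map_of_mem hv
      rw [Submodule.map_span] at this
      exact Submodule.span_le_restrictScalars k[X] K _ this
    rw [map_smul, ← algebraMap_smul K g (φ v)] at h1
    exact (Submodule.smul_mem_iff _ hgK).1 h1
  have hdet : φ (M.det • v) = ∑ j, algebraMap k[X] K (x j) • B j := by
    rw [hx, map_sum]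
    refine Finset.sum_congr rfl fun j _ => ?_
    rw [map_smul, hWB, algebraMap_smul]
  have hmem : ∑ j, algebraMap k[X] K (x j) • B j ∈
      Submodule.span K (B '' {j | B j ∈ φ '' C}) := by
    rw [← hdet, map_smul, ← algebraMap_smul K M.det (φ v)]
    exact Submodule.smul_mem _ _ (hBs hvK)
  -- Over `K` the vector lies in the span of the basis vectors coming from `C`; by uniqueness of
  -- coordinates, the other entries of `x` vanish.
  rw [Finsupp.mem_span_image_iff_linearCombination] at hmem
  obtain ⟨l, hl, hls⟩ := hmem
  have hlx : l = Finsupp.equivFunOnFinite.symm fun j => algebraMap k[X] K (x j) := by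
    refine hBi ?_
    rw [hls, Finsupp.linearCombination_apply, Finsupp.sum_fintype _ _ (by simp)]
    rfl
  rw [hx]
  refine Submodule.sum_mem _ fun j _ => ?_
  by_cases hj : B j ∈ φ '' C
  · exact Submodule.smul_mem _ _ (Submodule.subset_span (hWC j hj))
  · have h0 : l j = 0 := by
      by_contra h
      exact hj (hl (Finsupp.mem_support_iff.2 h))
    rw [hlx] at h0
    have : x j = 0 := by simpa using h0
    rw [this, zero_smul]
    exact Submodule.zero_mem _

/-- Counted with multiplicity, `e` has at most `n` irreducible factors, and each divides `s`. The
uncontrolled exponent `N` is traded for a degree bound. -/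
theorem Polynomial.dvd_pow_natDegree_of_dvd_pow {k : Type*} [Field k] (s : k[X]) (N : ℕ) :
    ∀ (n : ℕ) (e : k[X]), e ≠ 0 → e.natDegree ≤ n → e ∣ s ^ N → e ∣ s ^ n := by
  intro n
  induction n with
  | zero =>
    intro e he hn _
    exact (Polynomial.isUnit_iff_degree_eq_zero.2 (by
      rw [degree_eq_natDegree he]; simp_all)).dvd
  | succ n ih =>
    intro e he hn hd
    by_cases hu : IsUnit e
    · exact hu.dvd
    obtain ⟨π, hπ, e', rfl⟩ := WfDvdMonoid.exists_irreducible_factor hu he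
    have hπs : π ∣ s := hπ.prime.dvd_of_dvd_pow ((Dvd.intro _ rfl).trans hd)
    have he' : e' ≠ 0 := right_ne_zero_of_mul he
    rw [natDegree_mul hπ.ne_zero he'] at hn
    have := hπ.natDegree_pos
    rw [pow_succ']
    exact mul_dvd_mul hπs (ih e' he' (by omega) ((Dvd.intro_left _ rfl).trans hd))

/-! ### Frobenius powers and torsion closures -/

theorem Ideal.pow_mem_frobeniusPower {R : Type*} [CommRing R] {I : Ideal R} (q : ℕ) {a : R}
    (ha : a ∈ I) : a ^ q ∈ I.frobeniusPower q :=
  Ideal.subset_span ⟨a, ha, rfl⟩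

/-- The elements of an algebra over a domain that are torsion modulo an ideal. -/
def Ideal.torsionClosure (A : Type*) {R : Type*} [CommRing A] [IsDomain A] [CommRing R]
    [Algebra A R] (J : Ideal R) : Ideal R where
  carrier := {z | ∃ g : A, g ≠ 0 ∧ g • z ∈ J}
  zero_mem' := ⟨1, one_ne_zero, by simp⟩
  add_mem' := by
    rintro a b ⟨g, hg, ha⟩ ⟨h, hh, hb⟩
    refine ⟨g * h, mul_ne_zero hg hh, ?_⟩
    rw [smul_add]
    refine J.add_mem ?_ ?_
    · rw [mul_comm, mul_smul, Algebra.smul_def]; exact J.mul_mem_left _ ha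
    · rw [mul_smul, Algebra.smul_def]; exact J.mul_mem_left _ hb
  smul_mem' := by
    rintro c z ⟨g, hg, hz⟩
    exact ⟨g, hg, by rw [smul_comm]; exact J.mul_mem_left _ hz⟩

theorem Ideal.mem_torsionClosure {A R : Type*} [CommRing A] [IsDomain A] [CommRing R]
    [Algebra A R] {J : Ideal R} {z : R} :
    z ∈ J.torsionClosure A ↔ ∃ g : A, g ≠ 0 ∧ g • z ∈ J := Iff.rfl

theorem Ideal.le_torsionClosure {A R : Type*} [CommRing A] [IsDomain A] [CommRing R]
    [Algebra A R] (J : Ideal R) : J ≤ J.torsionClosure A :=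
  fun z hz => ⟨1, one_ne_zero, by simpa using hz⟩

/-- Multiply the annihilators of finitely many generators. The degree of `g` is not controlled; only
its set of prime factors is used later. -/
theorem Ideal.exists_smul_mem_of_mem_torsionClosure {A R : Type*} [CommRing A] [IsDomain A]
    [CommRing R] [Algebra A R] [IsNoetherianRing R] (J : Ideal R) :
    ∃ g : A, g ≠ 0 ∧ ∀ z ∈ J.torsionClosure A, g • z ∈ J := by
  classical
  obtain ⟨S, hS⟩ := IsNoetherian.noetherian (J.torsionClosure A)
  have hS' : ∀ z ∈ S, ∃ g : A, g ≠ 0 ∧ g • z ∈ J := fun z hz =>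
    Ideal.mem_torsionClosure.1 (hS ▸ Submodule.subset_span hz)
  choose! g hg hgz using hS'
  refine ⟨∏ z ∈ S, g z, Finset.prod_ne_zero_iff.2 hg, fun z hz => ?_⟩
  rw [← hS] at hz
  induction hz using Submodule.span_induction with
  | mem z hz =>
    rw [← Finset.prod_erase_mul S g hz, mul_smul, Algebra.smul_def]
    exact J.mul_mem_left _ (hgz z hz)
  | zero => simp
  | add a b _ _ ha hb => rw [smul_add]; exact J.add_mem ha hb
  | smul c z _ hz => rw [smul_comm]; exact J.mul_mem_left _ hz

/-- In `R ⧸ J`, pairwise coprime principal ideals intersect in their product. -/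
theorem Ideal.finset_inf_sup_span_singleton_le {R ι : Type*} [CommRing R] (J : Ideal R)
    (T : Finset ι) (f : ι → R)
    (hf : (T : Set ι).Pairwise fun i j => IsCoprime (f i) (f j)) :
    (T.inf fun i => J ⊔ Ideal.span {f i}) ≤ J ⊔ Ideal.span {∏ i ∈ T, f i} := by
  have key : ∀ a : R, J ⊔ Ideal.span {a} =
      (Ideal.span {Ideal.Quotient.mk J a}).comap (Ideal.Quotient.mk J) := by
    intro a
    rw [← Set.image_singleton, ← Ideal.map_span, Ideal.comap_map_of_surjective _
      Ideal.Quotient.mk_surjective, ← RingHom.ker_eq_comap_bot, Ideal.mk_ker, sup_comm]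
  intro z hz
  rw [key, Ideal.mem_comap, map_prod, ← Ideal.finset_inf_span_singleton]
  · rw [Submodule.mem_finsetInf] at hz ⊢
    intro i hi
    have := hz i hi
    rw [key] at this
    exact this
  · exact fun i hi j hj hij => (hf hi hj hij).map (Ideal.Quotient.mk J)

theorem charP_of_retraction {k : Type*} [Field k] (p : ℕ) [CharP k p] {R : Type*} [CommRing R]
    [Algebra k[X] R] (ε : R →ₐ[k[X]] k[X]) : CharP R p := by
  have : Function.Injective (algebraMap k[X] R) :=
    Function.LeftInverse.injective (g := ε) fun a => by simp
  exact charP_of_injective_ringHom this p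

/-! ### Primary components of Frobenius powers of the kernel of a retraction -/

section Retraction

variable {k : Type*} [Field k] (p : ℕ) [Fact p.Prime] {R : Type*} [CommRing R]
  [Algebra k[X] R] (ε : R →ₐ[k[X]] k[X])

theorem frobeniusPower_le_ker (e : ℕ) :
    (RingHom.ker ε).frobeniusPower (p ^ e) ≤ RingHom.ker ε := by
  refine Ideal.span_le.2 ?_
  rintro _ ⟨a, ha, rfl⟩
  exact Ideal.pow_mem_of_mem _ ha _ (pow_pos (Fact.out : p.Prime).pos e)

theorem torsionClosure_le_ker (e : ℕ) :
    ((RingHom.ker ε).frobeniusPower (p ^ e)).torsionClosure k[X] ≤ RingHom.ker ε := by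
  rintro z ⟨g, hg, hz⟩
  have := frobeniusPower_le_ker p ε e hz
  rw [RingHom.mem_ker, map_smul, smul_eq_mul, mul_eq_zero] at this
  exact this.resolve_left hg

theorem radical_torsionClosure (e : ℕ) :
    (((RingHom.ker ε).frobeniusPower (p ^ e)).torsionClosure k[X]).radical =
      RingHom.ker ε := by
  have hprime : (RingHom.ker ε).IsPrime := RingHom.ker_isPrime _
  refine le_antisymm (hprime.radical_le_iff.2 (torsionClosure_le_ker p ε e)) fun z hz => ?_
  exact ⟨p ^ e, Ideal.le_torsionClosure _ (Ideal.pow_mem_frobeniusPower _ hz)⟩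

variable [CharP k p]

/-- The difference `z - ε z` lies in the kernel, and the Frobenius is additive. -/
theorem pow_sub_algebraMap_mem (e : ℕ) (z : R) :
    z ^ p ^ e - algebraMap k[X] R (ε z ^ p ^ e) ∈
      (RingHom.ker ε).frobeniusPower (p ^ e) := by
  have := charP_of_retraction p ε
  rw [map_pow, ← sub_pow_char_pow]
  exact Ideal.pow_mem_frobeniusPower _ (by simp [RingHom.mem_ker])

/-- If `a * b` is torsion and `ε b ≠ 0`, then so is `b^q * a`; modulo the Frobenius power `b^q` is
the nonzero scalar `ε(b)^q`, so `a` is torsion. -/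
theorem isPrimary_torsionClosure (e : ℕ) :
    (((RingHom.ker ε).frobeniusPower (p ^ e)).torsionClosure k[X]).IsPrimary := by
  have hprime : (RingHom.ker ε).IsPrime := RingHom.ker_isPrime _
  rw [Ideal.isPrimary_iff]
  refine ⟨fun h => hprime.ne_top (top_le_iff.1 (h ▸ torsionClosure_le_ker p ε e)), ?_⟩
  intro a b hab
  rw [radical_torsionClosure, or_iff_not_imp_right]
  intro hb
  have h1 : b ^ p ^ e * a ∈ ((RingHom.ker ε).frobeniusPower (p ^ e)).torsionClosure k[X] := by
    obtain ⟨m, hm⟩ := Nat.exists_eq_add_one.2 (pow_pos (Fact.out : p.Prime).pos e)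
    have : b ^ p ^ e * a = b ^ m * (a * b) := by rw [hm]; ring
    rw [this]
    exact Ideal.mul_mem_left _ _ hab
  have h2 := Ideal.mul_mem_right a _
    (Ideal.le_torsionClosure (A := k[X]) _ (pow_sub_algebraMap_mem p ε e b))
  have h3 := Ideal.sub_mem _ h1 h2
  rw [← sub_mul, sub_sub_cancel, ← Algebra.smul_def] at h3
  obtain ⟨g, hg, h⟩ := h3
  exact ⟨g * ε b ^ p ^ e, mul_ne_zero hg (pow_ne_zero _ hb), by rwa [mul_smul]⟩

/-- The primary component of the `q`-th Frobenius power at the prime `τ`. -/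
def primaryComponentAt (e c : ℕ) (τ : k[X]) : Ideal R :=
  (RingHom.ker ε).frobeniusPower (p ^ e) ⊔ Ideal.span {algebraMap k[X] R τ ^ (c * p ^ e)}

theorem pow_mem_primaryComponentAt (e c : ℕ) (τ : k[X]) (z : R) (hz : τ ^ c ∣ ε z) :
    z ^ p ^ e ∈ primaryComponentAt p ε e c τ := by
  rw [← sub_add_cancel (z ^ p ^ e) (algebraMap k[X] R (ε z ^ p ^ e))]
  refine Ideal.add_mem _ (Ideal.mem_sup_left (pow_sub_algebraMap_mem p ε e z))
    (Ideal.mem_sup_right (Ideal.mem_span_singleton.2 ?_))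
  rw [← map_pow, pow_mul]
  exact map_dvd _ (pow_dvd_pow_of_dvd hz _)

theorem radical_primaryComponentAt (e c : ℕ) (hc : c ≠ 0) (τ : k[X]) (hτ : Irreducible τ) :
    (primaryComponentAt p ε e c τ).radical = (Ideal.span {τ}).comap ε := by
  have hprime : (Ideal.span {τ}).IsPrime :=
    (Ideal.span_singleton_prime hτ.ne_zero).2 hτ.prime
  have hq : p ^ e ≠ 0 := pow_ne_zero _ (Fact.out : p.Prime).ne_zero
  refine le_antisymm ((hprime.comap ε).radical_le_iff.2 (sup_le ?_ ?_)) fun z hz => ?_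
  · refine (frobeniusPower_le_ker p ε e).trans fun z hz => ?_
    rw [Ideal.mem_comap, (RingHom.mem_ker).1 hz]
    exact Ideal.zero_mem _
  · rw [Ideal.span_singleton_le_iff_mem, Ideal.mem_comap, map_pow, AlgHom.commutes]
    exact Ideal.pow_mem_of_mem _ (Ideal.mem_span_singleton_self τ) _
      (Nat.pos_of_ne_zero (mul_ne_zero hc hq))
  · refine ⟨c * p ^ e, ?_⟩
    rw [pow_mul]
    refine pow_mem_primaryComponentAt p ε e c τ _ ?_
    rw [map_pow]
    exact pow_dvd_pow_of_dvd (Ideal.mem_span_singleton.1 hz) c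

theorem isPrimary_primaryComponentAt (e c : ℕ) (hc : c ≠ 0) (τ : k[X]) (hτ : Irreducible τ) :
    (primaryComponentAt p ε e c τ).IsPrimary := by
  refine Ideal.isPrimary_of_isMaximal_radical ?_
  rw [radical_primaryComponentAt p ε e c hc τ hτ]
  have : (Ideal.span {τ}).IsMaximal := PrincipalIdealRing.isMaximal_of_irreducible hτ
  exact Ideal.comap_isMaximal_of_surjective ε fun a => ⟨algebraMap k[X] R a, by simp⟩

theorem frobeniusPower_radical_primaryComponentAt_le (e c : ℕ) (hc : c ≠ 0) (τ : k[X])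
    (hτ : Irreducible τ) :
    ((primaryComponentAt p ε e c τ).radical ^ c).frobeniusPower (p ^ e) ≤
      primaryComponentAt p ε e c τ := by
  rw [radical_primaryComponentAt p ε e c hc τ hτ]
  refine Ideal.span_le.2 ?_
  rintro _ ⟨z, hz, rfl⟩
  refine pow_mem_primaryComponentAt p ε e c τ z ?_
  have := Ideal.le_comap_pow ε c hz
  rwa [Ideal.mem_comap, Ideal.span_singleton_pow, Ideal.mem_span_singleton] at this

/-- If the torsion modulo the `q`-th Frobenius power of the kernel of a retraction onto `k[X]` is
generated by elements with annihilators of degree at most `D * q`, then this kernel has linear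
growth of primary decompositions. -/
theorem hasLinearGrowthOfPrimaryDecompositions_ker [IsNoetherianRing R] (D : ℕ)
    (H : ∀ (e : ℕ), ∀ z ∈ ((RingHom.ker ε).frobeniusPower (p ^ e)).torsionClosure k[X],
      z ∈ Submodule.span k[X] {w : R | ∃ δ : k[X], δ ≠ 0 ∧ δ.natDegree ≤ D * p ^ e ∧
        δ • w ∈ (RingHom.ker ε).frobeniusPower (p ^ e)}) :
    HasLinearGrowthOfPrimaryDecompositions p (RingHom.ker ε) := by
  classical
  -- The exponent `D` already kills the torsion; adding 1 keeps it nonzero, so that the components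
  -- are proper.
  refine ⟨D + 1, fun e => ?_⟩
  set J := (RingHom.ker ε).frobeniusPower (p ^ e) with hJ
  obtain ⟨g, hg, hgJ⟩ := J.exists_smul_mem_of_mem_torsionClosure (A := k[X])
  let T : Finset k[X] := (UniqueFactorizationMonoid.normalizedFactors g).toFinset
  have hT : ∀ τ ∈ T, Irreducible τ := fun τ hτ =>
    UniqueFactorizationMonoid.irreducible_of_normalized_factor τ (Multiset.mem_toFinset.1 hτ)
  have hTn : ∀ τ ∈ T, normalize τ = τ := fun τ hτ =>
    UniqueFactorizationMonoid.normalize_normalized_factor τ (Multiset.mem_toFinset.1 hτ)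
  let s : k[X] := ∏ τ ∈ T, τ
  have hgs : ∃ N, g ∣ s ^ N := by
    refine ⟨(UniqueFactorizationMonoid.normalizedFactors g).card, ?_⟩
    refine (UniqueFactorizationMonoid.prod_normalizedFactors hg).symm.dvd.trans ?_
    rw [← Multiset.prod_replicate, ← Multiset.map_const']
    nth_rw 1 [← Multiset.map_id (UniqueFactorizationMonoid.normalizedFactors g)]
    refine Multiset.prod_dvd_prod_of_dvd _ _ fun τ hτ => ?_
    exact Finset.dvd_prod_of_mem _ (Multiset.mem_toFinset.2 hτ)
  obtain ⟨N, hN⟩ := hgs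
  -- For a generator `w`, `gcd g δ` still kills `w` modulo `J`; it divides a power of `s` because
  -- `g` does, and has degree at most `D * q` because `δ` does.
  have hkill : ∀ z ∈ J.torsionClosure k[X], s ^ (D * p ^ e) • z ∈ J := by
    intro z hz
    have hz' := H e z hz
    rw [← hJ] at hz'
    refine Submodule.span_induction (p := fun w _ => s ^ (D * p ^ e) • w ∈ J)
      ?_ (by simp) ?_ ?_ hz'
    · rintro w ⟨δ, hδ, hδd, hw⟩
      have h1 : g • w ∈ J := hgJ w ⟨δ, hδ, hw⟩
      have h2 : EuclideanDomain.gcd g δ • w ∈ J := by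
        rw [EuclideanDomain.gcd_eq_gcd_ab, add_smul, mul_comm g, mul_comm δ, mul_smul, mul_smul,
          Algebra.smul_def _ (g • w), Algebra.smul_def _ (δ • w)]
        exact J.add_mem (J.mul_mem_left _ h1) (J.mul_mem_left _ hw)
      have hdvd := EuclideanDomain.gcd_dvd_right g δ
      obtain ⟨a, ha⟩ := Polynomial.dvd_pow_natDegree_of_dvd_pow s N (D * p ^ e)
        (EuclideanDomain.gcd g δ) (ne_zero_of_dvd_ne_zero hδ hdvd)
        ((natDegree_le_of_dvd hdvd hδ).trans hδd)
        ((EuclideanDomain.gcd_dvd_left g δ).trans hN)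
      rw [ha, mul_comm, mul_smul, Algebra.smul_def]
      exact J.mul_mem_left _ h2
    · intro a b _ _ ha hb
      rw [smul_add]; exact J.add_mem ha hb
    · intro a w _ hw
      rw [smul_comm, Algebra.smul_def]; exact J.mul_mem_left _ hw
  refine ⟨insert (J.torsionClosure k[X]) (T.image (primaryComponentAt p ε e (D + 1))), ?_, ?_, ?_⟩
  · intro Q hQ
    rcases Finset.mem_insert.1 hQ with rfl | hQ
    · exact isPrimary_torsionClosure p ε e
    · obtain ⟨τ, hτ, rfl⟩ := Finset.mem_image.1 hQ
      exact isPrimary_primaryComponentAt p ε e _ D.succ_ne_zero τ (hT τ hτ)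
  · rw [Finset.inf_insert, Finset.inf_image, id, Function.id_comp]
    refine le_antisymm ?_ (le_inf J.le_torsionClosure (Finset.le_inf fun τ _ => le_sup_left))
    rintro z ⟨hz, hz'⟩
    have hcop : (T : Set k[X]).Pairwise fun i j =>
        IsCoprime (algebraMap k[X] R i ^ ((D + 1) * p ^ e))
          (algebraMap k[X] R j ^ ((D + 1) * p ^ e)) := by
      intro i hi j hj hij
      refine IsCoprime.pow (IsCoprime.map ?_ (algebraMap k[X] R))
      refine (hT i hi).coprime_iff_not_dvd.2 fun h => hij ?_
      rw [← hTn i hi, ← hTn j hj]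
      exact normalize_eq_normalize h (((hT i hi).associated_of_dvd (hT j hj) h).symm.dvd)
    -- So the element is `a + s^((D+1)q) * r` with `a ∈ J`. Being torsion, it forces `r` to be
    -- torsion, and then `s^(Dq) • r ∈ J`.
    have h1 := Ideal.finset_inf_sup_span_singleton_le J T _ hcop hz'
    rw [Finset.prod_pow, ← map_prod, ← map_pow] at h1
    obtain ⟨a, ha, b, hb, rfl⟩ := Submodule.mem_sup.1 h1
    obtain ⟨r, rfl⟩ := Ideal.mem_span_singleton.1 hb
    refine J.add_mem ha ?_
    have h2 := Ideal.sub_mem _ hz (J.le_torsionClosure (A := k[X]) ha)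
    rw [add_sub_cancel_left, ← Algebra.smul_def] at h2
    obtain ⟨h, hh, h3⟩ := h2
    have hs : s ≠ 0 := Finset.prod_ne_zero_iff.2 fun τ hτ => (hT τ hτ).ne_zero
    have h4 := hkill r ⟨h * s ^ ((D + 1) * p ^ e), mul_ne_zero hh (pow_ne_zero _ hs), by
      rwa [mul_smul]⟩
    rw [add_mul, pow_add, mul_comm (s ^ _), map_mul, mul_assoc, ← Algebra.smul_def _ r]
    exact J.mul_mem_left _ h4
  · intro Q hQ
    rcases Finset.mem_insert.1 hQ with rfl | hQ
    · rw [hJ, radical_torsionClosure]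
      refine le_trans ?_ (Ideal.le_torsionClosure _)
      exact Ideal.span_mono (Set.image_mono (Ideal.pow_le_self D.succ_ne_zero))
    · obtain ⟨τ, hτ, rfl⟩ := Finset.mem_image.1 hQ
      exact frobeniusPower_radical_primaryComponentAt_le p ε e _ D.succ_ne_zero τ (hT τ hτ)

end Retraction

/-! ### The multigrading and its small monomials -/

namespace SSHypersurface

/-- The multigrading on `k[t][u,v,x,y]` for which `ux` and `vy` have the same degree. -/
def multidegree : Fin 4 → ℤ × ℤ × ℤ := ![(1, 0, 1), (0, 1, 1), (-1, 0, 0), (0, -1, 0)]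

theorem weight_multidegree (m : Fin 4 →₀ ℕ) :
    Finsupp.weight multidegree m = ((m 0 : ℤ) - m 2, (m 1 : ℤ) - m 3, (m 0 : ℤ) + m 1) := by
  rw [Finsupp.weight_apply, Finsupp.sum_fintype _ _ (by simp), Fin.sum_univ_four]
  simp [multidegree, sub_eq_add_neg]

/-- The exponents of the monomials of multidegree `c` in which all variables have exponents less
than `q`. -/
abbrev SmallExponent (q : ℕ) (c : ℤ × ℤ × ℤ) : Type :=
  {m : Fin 4 →₀ ℕ // (∀ i, m i < q) ∧ Finsupp.weight multidegree m = c}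

/-- The multidegree fixes `m 0 - m 2`, `m 1 - m 3` and `m 0 + m 1`, so `m 0 < q` determines all
exponents. This is the source of linearity in `q`. -/
theorem SmallExponent.injective (q : ℕ) (c : ℤ × ℤ × ℤ) :
    Function.Injective fun m : SmallExponent q c => (⟨m.1 0, m.2.1 0⟩ : Fin q) := by
  rintro ⟨m, hm, hmc⟩ ⟨n, hn, hnc⟩ h
  have h0 : m 0 = n 0 := by simpa using h
  rw [← hnc, weight_multidegree, weight_multidegree] at hmc
  simp only [Prod.mk.injEq] at hmc
  obtain ⟨h1, h2, h3⟩ := hmc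
  refine Subtype.ext (Finsupp.ext fun i => ?_)
  change m i = n i
  fin_cases i <;> simp <;> omega

instance (q : ℕ) (c : ℤ × ℤ × ℤ) : Fintype (SmallExponent q c) :=
  Fintype.ofInjective _ (SmallExponent.injective q c)

theorem SmallExponent.card_le (q : ℕ) (c : ℤ × ℤ × ℤ) :
    Fintype.card (SmallExponent q c) ≤ q := by
  simpa using Fintype.card_le_of_injective _ (SmallExponent.injective q c)

variable {k : Type*} [Field k] (q : ℕ) (c : ℤ × ℤ × ℤ)

/-- The coefficients of the small monomials of multidegree `c`. -/
def smallCoeff : PolyRing k →ₗ[k[X]] (SmallExponent q c → k[X]) :=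
  LinearMap.pi fun m => MvPolynomial.lcoeff k[X] m.1

@[simp]
theorem smallCoeff_apply (f : PolyRing k) (m : SmallExponent q c) :
    smallCoeff q c f m = MvPolynomial.coeff m.1 f := rfl

/-- The polynomial with given coefficients at the small monomials of multidegree `c`. -/
def ofSmallCoeff : (SmallExponent q c → k[X]) →ₗ[k[X]] PolyRing k :=
  Fintype.linearCombination k[X] fun m : SmallExponent q c => MvPolynomial.monomial m.1 1

open Classical in
theorem coeff_ofSmallCoeff (v : SmallExponent q c → k[X]) (m : Fin 4 →₀ ℕ) :
    MvPolynomial.coeff m (ofSmallCoeff q c v) =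
      if h : (∀ i, m i < q) ∧ Finsupp.weight multidegree m = c then v ⟨m, h⟩ else 0 := by
  rw [ofSmallCoeff, Fintype.linearCombination_apply, MvPolynomial.coeff_sum]
  simp only [MvPolynomial.coeff_smul, MvPolynomial.coeff_monomial, smul_eq_mul, mul_ite, mul_one,
    mul_zero]
  split_ifs with h
  · rw [Finset.sum_eq_single ⟨m, h⟩]
    · simp
    · intro b _ hb
      exact if_neg fun hbm => hb (Subtype.ext hbm)
    · simp
  · refine Finset.sum_eq_zero fun b _ => if_neg ?_
    rintro rfl
    exact h b.2

theorem mem_span_X_pow (f : PolyRing k) :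
    f ∈ Ideal.span (Set.range fun i : Fin 4 => (MvPolynomial.X i : PolyRing k) ^ q) ↔
      ∀ m, (∀ i, m i < q) → MvPolynomial.coeff m f = 0 := by
  have : (Set.range fun i : Fin 4 => (MvPolynomial.X i : PolyRing k) ^ q) =
      (fun s => MvPolynomial.monomial s (1 : k[X])) ''
        (Set.range fun i : Fin 4 => Finsupp.single i q) := by
    rw [← Set.range_comp]
    simp [Function.comp_def, MvPolynomial.X_pow_eq_monomial]
  rw [this, MvPolynomial.mem_ideal_span_monomial_image]
  simp only [MvPolynomial.mem_support_iff, Set.exists_range_iff, Finsupp.single_le_iff]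
  refine forall_congr' fun m => ?_
  rw [← not_imp_not]
  simp

variable {q c} {F : PolyRing k} {d : ℤ × ℤ × ℤ}

/-- The ideal is multihomogeneous: a monomial multiple of `F` lives in one multidegree, so the
projection either kills it or keeps it modulo the `q`-th powers. -/
theorem ofSmallCoeff_smallCoeff_mem (hF : F.IsWeightedHomogeneous multidegree d)
    {f : PolyRing k}
    (hf : f ∈ Ideal.span (Set.range fun i : Fin 4 => (MvPolynomial.X i : PolyRing k) ^ q) ⊔
      Ideal.span {F}) :
    ofSmallCoeff q c (smallCoeff q c f) ∈
      Ideal.span (Set.range fun i : Fin 4 => (MvPolynomial.X i : PolyRing k) ^ q) ⊔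
      Ideal.span {F} := by
  classical
  obtain ⟨a, ha, b, hb, rfl⟩ := Submodule.mem_sup.1 hf
  obtain ⟨h, rfl⟩ := Ideal.mem_span_singleton.1 hb
  have ha0 : smallCoeff q c a = 0 := by
    ext1 m
    exact (mem_span_X_pow q a).1 ha m.1 m.2.1
  rw [map_add, ha0, zero_add]
  clear hf hb ha ha0
  induction h using MvPolynomial.induction_on' with
  | add p₁ p₂ h₁ h₂ =>
    rw [mul_add, map_add, map_add]
    exact Ideal.add_mem _ h₁ h₂
  | monomial n r =>
    have hhom : (F * MvPolynomial.monomial n r).IsWeightedHomogeneous multidegree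
        (d + Finsupp.weight multidegree n) :=
      hF.mul (MvPolynomial.isWeightedHomogeneous_monomial _ _ _ rfl)
    by_cases hc : d + Finsupp.weight multidegree n = c
    -- What the projection drops involves only monomials with some exponent at least `q`.
    · rw [← sub_sub_cancel (F * MvPolynomial.monomial n r) (ofSmallCoeff q c _)]
      refine Ideal.sub_mem _ (Ideal.mem_sup_right (Ideal.mul_mem_right _ _
        (Ideal.mem_span_singleton_self F))) (Ideal.mem_sup_left ?_)
      rw [mem_span_X_pow]
      intro m hm
      rw [MvPolynomial.coeff_sub, coeff_ofSmallCoeff]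
      split_ifs with h
      · simp
      · rw [sub_zero]
        by_contra hne
        exact h ⟨hm, (hhom hne).trans hc⟩
    · have : smallCoeff q c (F * MvPolynomial.monomial n r) = 0 := by
        ext1 m
        by_contra hne
        exact hc ((hhom hne).symm.trans m.2.2)
      rw [this, map_zero]
      exact Ideal.zero_mem _

/-- The vectors of the span are the columns of a presentation matrix of the multidegree `c` piece;
their entries are coefficients of `F` or zero. -/
theorem smallCoeff_mem_span {f : PolyRing k}
    (hf : f ∈ Ideal.span (Set.range fun i : Fin 4 => (MvPolynomial.X i : PolyRing k) ^ q) ⊔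
      Ideal.span {F}) :
    smallCoeff q c f ∈ Submodule.span k[X]
      (Set.range fun n => smallCoeff q c (F * MvPolynomial.monomial n 1)) := by
  obtain ⟨a, ha, b, hb, rfl⟩ := Submodule.mem_sup.1 hf
  obtain ⟨h, rfl⟩ := Ideal.mem_span_singleton.1 hb
  have ha0 : smallCoeff q c a = 0 := by
    ext1 m
    exact (mem_span_X_pow q a).1 ha m.1 m.2.1
  rw [map_add, ha0, zero_add]
  clear hf hb ha ha0
  induction h using MvPolynomial.induction_on' with
  | add p₁ p₂ h₁ h₂ =>
    rw [mul_add, map_add]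
    exact Submodule.add_mem _ h₁ h₂
  | monomial n r =>
    have : MvPolynomial.monomial n r = r • MvPolynomial.monomial n (1 : k[X]) := by
      rw [MvPolynomial.smul_monomial, smul_eq_mul, mul_one]
    rw [this, mul_smul_comm, map_smul]
    exact Submodule.smul_mem _ _ (Submodule.subset_span ⟨n, rfl⟩)

theorem exists_smul_ofSmallCoeff_mem (hF : F.IsWeightedHomogeneous multidegree d) {D : ℕ}
    (hD : ∀ m, (MvPolynomial.coeff m F).natDegree ≤ D) {f : PolyRing k} {g : k[X]} (hg : g ≠ 0)
    (hf : g • f ∈ Ideal.span (Set.range fun i : Fin 4 => (MvPolynomial.X i : PolyRing k) ^ q) ⊔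
      Ideal.span {F}) (c : ℤ × ℤ × ℤ) :
    ∃ δ : k[X], δ ≠ 0 ∧ δ.natDegree ≤ D * q ∧ δ • ofSmallCoeff q c (smallCoeff q c f) ∈
      Ideal.span (Set.range fun i : Fin 4 => (MvPolynomial.X i : PolyRing k) ^ q) ⊔
      Ideal.span {F} := by
  have h1 := smallCoeff_mem_span (c := c) hf
  rw [map_smul] at h1
  obtain ⟨δ, hδ, hδD, hmem⟩ := exists_natDegree_le_smul_mem_span (FractionRing k[X]) _ D
    (by
      rintro _ ⟨n, rfl⟩ m
      change (MvPolynomial.coeff m.1 (F * MvPolynomial.monomial n 1)).natDegree ≤ D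
      rw [MvPolynomial.coeff_mul_monomial']
      split_ifs
      · rw [mul_one]; exact hD _
      · simp) _ g hg h1
  refine ⟨δ, hδ, hδD.trans ?_, ?_⟩
  · rw [mul_comm]
    exact Nat.mul_le_mul_left D (SmallExponent.card_le q c)
  · rw [← map_smul]
    refine Submodule.span_induction
      (p := fun v _ => ofSmallCoeff q c v ∈
        Ideal.span (Set.range fun i : Fin 4 => (MvPolynomial.X i : PolyRing k) ^ q) ⊔
        Ideal.span {F}) ?_ (by simp) ?_ ?_ hmem
    · rintro _ ⟨n, rfl⟩
      exact ofSmallCoeff_smallCoeff_mem hF (Ideal.mem_sup_right (Ideal.mul_mem_right _ _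
        (Ideal.mem_span_singleton_self F)))
    · intro a b _ _ ha hb
      rw [map_add]
      exact Ideal.add_mem _ ha hb
    · intro a v _ hv
      rw [map_smul, Algebra.smul_def]
      exact Ideal.mul_mem_left _ _ hv

theorem sub_sum_ofSmallCoeff_mem (q : ℕ) (f : PolyRing k) :
    f - ∑ c ∈ f.support.image (Finsupp.weight multidegree),
        ofSmallCoeff q c (smallCoeff q c f) ∈
      Ideal.span (Set.range fun i : Fin 4 => (MvPolynomial.X i : PolyRing k) ^ q) := by
  rw [mem_span_X_pow]
  intro m hm
  rw [MvPolynomial.coeff_sub, MvPolynomial.coeff_sum, sub_eq_zero]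
  simp only [coeff_ofSmallCoeff]
  by_cases hmf : MvPolynomial.coeff m f = 0
  · rw [hmf, Finset.sum_eq_zero]
    intro c _
    split_ifs
    · exact hmf
    · rfl
  · rw [Finset.sum_eq_single_of_mem (Finsupp.weight multidegree m)
      (Finset.mem_image_of_mem _ (MvPolynomial.mem_support_iff.2 hmf)), dif_pos ⟨hm, rfl⟩]
    · rfl
    · intro c _ hc
      exact dif_neg fun h => hc h.2.symm

/-- The torsion modulo `(u^q, v^q, x^q, y^q, F)`, for a multihomogeneous `F`, is generated by
elements with annihilators of degree at most `D * q`. -/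
theorem mem_span_torsion (hF : F.IsWeightedHomogeneous multidegree d) {D : ℕ}
    (hD : ∀ m, (MvPolynomial.coeff m F).natDegree ≤ D) {f : PolyRing k} {g : k[X]} (hg : g ≠ 0)
    (hf : g • f ∈ Ideal.span (Set.range fun i : Fin 4 => (MvPolynomial.X i : PolyRing k) ^ q) ⊔
      Ideal.span {F}) :
    f ∈ Submodule.span k[X] {w : PolyRing k | ∃ δ : k[X], δ ≠ 0 ∧ δ.natDegree ≤ D * q ∧ δ • w ∈
      Ideal.span (Set.range fun i : Fin 4 => (MvPolynomial.X i : PolyRing k) ^ q) ⊔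
      Ideal.span {F}} := by
  rw [← sub_add_cancel f (∑ c ∈ f.support.image (Finsupp.weight multidegree),
        ofSmallCoeff q c (smallCoeff q c f))]
  refine Submodule.add_mem _ (Submodule.subset_span ⟨1, one_ne_zero, by simp, ?_⟩)
    (Submodule.sum_mem _ fun c _ => Submodule.subset_span
      (exists_smul_ofSmallCoeff_mem hF hD hg hf c))
  rw [one_smul]
  exact Ideal.mem_sup_left (sub_sum_ofSmallCoeff_mem q f)

/-! ### The hypersurface -/

variable (r₀ r₁ r₂ : k[X])

theorem isWeightedHomogeneous_equation :
    (equation r₀ r₁ r₂).IsWeightedHomogeneous multidegree (0, 0, 2) := by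
  have hC (r : k[X]) : (MvPolynomial.C r : PolyRing k).IsWeightedHomogeneous multidegree 0 :=
    MvPolynomial.isWeightedHomogeneous_C _ r
  have hX (i : Fin 4) : (MvPolynomial.X i : PolyRing k).IsWeightedHomogeneous multidegree
      (multidegree i) := MvPolynomial.isWeightedHomogeneous_X _ _ i
  have h₀ := ((hC r₀).mul ((hX 0).pow 2)).mul ((hX 2).pow 2)
  have h₁ := ((((hC r₁).mul (hX 0)).mul (hX 2)).mul (hX 1)).mul (hX 3)
  have h₂ := ((hC r₂).mul ((hX 1).pow 2)).mul ((hX 3).pow 2)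
  exact Submodule.add_mem (MvPolynomial.weightedHomogeneousSubmodule k[X] multidegree (0, 0, 2))
    (Submodule.add_mem _ (by simpa [multidegree] using h₀) (by simpa [multidegree] using h₁))
    (by simpa [multidegree] using h₂)

theorem natDegree_coeff_equation_le (m : Fin 4 →₀ ℕ) :
    (MvPolynomial.coeff m (equation r₀ r₁ r₂)).natDegree ≤
      (equation r₀ r₁ r₂).support.sup
        fun m => (MvPolynomial.coeff m (equation r₀ r₁ r₂)).natDegree := by
  by_cases hm : MvPolynomial.coeff m (equation r₀ r₁ r₂) = 0
  · simp [hm]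
  · exact Finset.le_sup (f := fun m => (MvPolynomial.coeff m (equation r₀ r₁ r₂)).natDegree)
      (MvPolynomial.mem_support_iff.2 hm)

/-- The retraction of the coordinate ring onto `k[t]` that sends `u, v, x, y` to zero. -/
def retraction : CoordRing r₀ r₁ r₂ →ₐ[k[X]] k[X] :=
  Ideal.Quotient.liftₐ _ (MvPolynomial.aeval fun _ => 0) fun a ha => by
    obtain ⟨b, rfl⟩ := Ideal.mem_span_singleton.1 ha
    simp [equation]

theorem ker_retraction : RingHom.ker (retraction r₀ r₁ r₂) = idealUVXY r₀ r₁ r₂ := by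
  refine le_antisymm (fun z hz => ?_) (Ideal.span_le.2 ?_)
  · obtain ⟨f, rfl⟩ := Ideal.Quotient.mk_surjective z
    have hf : MvPolynomial.coeff 0 f = 0 := by
      have : MvPolynomial.aeval (fun _ : Fin 4 => (0 : k[X])) f = 0 := hz
      simpa [MvPolynomial.aeval_zero', MvPolynomial.constantCoeff_eq] using this
    -- With exponent 1, the only small monomial is the constant one.
    have : f ∈ Ideal.span (Set.range fun i : Fin 4 => (MvPolynomial.X i : PolyRing k) ^ 1) := by
      rw [mem_span_X_pow]
      intro m hm
      have : m = 0 := Finsupp.ext fun i => Nat.lt_one_iff.1 (hm i)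
      rw [this, hf]
    have := Ideal.mem_map_of_mem (Ideal.Quotient.mk (Ideal.span {equation r₀ r₁ r₂})) this
    rw [Ideal.map_span, ← Set.range_comp] at this
    simpa [idealUVXY, Function.comp_def] using this
  · rintro _ ⟨i, rfl⟩
    change MvPolynomial.aeval (fun _ : Fin 4 => (0 : k[X])) (MvPolynomial.X i) = 0
    simp

theorem mk_mem_frobeniusPower_iff (p : ℕ) [Fact p.Prime] [CharP k p] (e : ℕ) (f : PolyRing k) :
    Ideal.Quotient.mk (Ideal.span {equation r₀ r₁ r₂}) f ∈
        (idealUVXY r₀ r₁ r₂).frobeniusPower (p ^ e) ↔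
      f ∈ Ideal.span (Set.range fun i : Fin 4 => (MvPolynomial.X i : PolyRing k) ^ p ^ e) ⊔
        Ideal.span {equation r₀ r₁ r₂} := by
  have := charP_of_retraction (R := CoordRing r₀ r₁ r₂) p (retraction r₀ r₁ r₂)
  have h : Ideal.frobeniusPower (R := CoordRing r₀ r₁ r₂) (p ^ e) (idealUVXY r₀ r₁ r₂) =
      (Ideal.span (Set.range fun i : Fin 4 => (MvPolynomial.X i : PolyRing k) ^ p ^ e)).map
        (Ideal.Quotient.mk (Ideal.span {equation r₀ r₁ r₂})) := by
    rw [idealUVXY, Ideal.frobeniusPower_span, Ideal.map_span, ← Set.range_comp, ← Set.range_comp]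
    simp [Function.comp_def]
  rw [h, ← Ideal.mem_comap, Ideal.comap_map_of_surjective _ Ideal.Quotient.mk_surjective,
    ← RingHom.ker_eq_comap_bot, Ideal.mk_ker]

theorem hasLinearGrowthOfPrimaryDecompositions_idealUVXY (p : ℕ) [Fact p.Prime] [CharP k p] :
    HasLinearGrowthOfPrimaryDecompositions (R := CoordRing r₀ r₁ r₂) p (idealUVXY r₀ r₁ r₂) := by
  rw [← ker_retraction]
  refine hasLinearGrowthOfPrimaryDecompositions_ker (R := CoordRing r₀ r₁ r₂) p _
    ((equation r₀ r₁ r₂).support.sup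
      fun m => (MvPolynomial.coeff m (equation r₀ r₁ r₂)).natDegree) fun e z hz => ?_
  rw [ker_retraction] at hz ⊢
  obtain ⟨g, hg, hgz⟩ := hz
  obtain ⟨f, rfl⟩ := Ideal.Quotient.mk_surjective z
  have h1 := mem_span_torsion (isWeightedHomogeneous_equation r₀ r₁ r₂)
    (natDegree_coeff_equation_le r₀ r₁ r₂) hg
    ((mk_mem_frobeniusPower_iff r₀ r₁ r₂ p e (g • f)).1 hgz)
  have h2 := Submodule.mem_map_of_mem
    (f := (Ideal.Quotient.mkₐ k[X] (Ideal.span {equation r₀ r₁ r₂})).toLinearMap) h1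
  rw [Submodule.map_span] at h2
  refine Submodule.span_mono ?_ h2
  rintro _ ⟨w, ⟨δ, hδ, hδD, hw⟩, rfl⟩
  exact ⟨δ, hδ, hδD, (mk_mem_frobeniusPower_iff r₀ r₁ r₂ p e (δ • w)).2 hw⟩

end SSHypersurface

end

theorem mainTheorem1 {k : Type*} [Field k] (p : ℕ) [Fact p.Prime] [CharP k p] :
    (∀ r₀ r₁ r₂ : k[X], r₀ * r₂ ≠ 0 →
      r₀.natDegree + r₂.natDegree < 2 * r₁.natDegree →
      HasLinearGrowthOfPrimaryDecompositions (R := SSHypersurface.CoordRing r₀ r₁ r₂) p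
        (SSHypersurface.idealUVXY r₀ r₁ r₂)) ∧
    HasLinearGrowthOfPrimaryDecompositions
      (R := SSHypersurface.CoordRing (1 : k[X]) (X : k[X]) (1 : k[X])) p
      (SSHypersurface.idealUVXY (1 : k[X]) (X : k[X]) (1 : k[X])) := by
  exact ⟨fun r₀ r₁ r₂ _ _ =>
    SSHypersurface.hasLinearGrowthOfPrimaryDecompositions_idealUVXY r₀ r₁ r₂ p,
    SSHypersurface.hasLinearGrowthOfPrimaryDecompositions_idealUVXY 1 X 1 p⟩
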